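/- Let $\mathbf{TP}_\omega$ be the category of countably based topological predomains and continuous maps: its objects are the second countable $T_0$ spaces ($qcb_0$ spaces with a countable base) in which every sequence that ascends in the order "$x \sqsubseteq y$ iff every open set containing $x$ contains $y$" has an upper bound to which it converges. For an object $D$ let $\mathcal O(D)$ be its lattice of open sets, ordered by inclusion, and let $[0,1]$ be ordered by $\le$, both with the Scott topology. Let $P(D)$ be the space of (continuous) valuations on $D$: the continuous maps $\nu : \mathcal O(D) \to [0,1]$ with $\nu(\emptyset) = 0$ and $\nu(U) + \nu(V) = \nu(U \cup V) + \nu(U \cap V)$ for all open $U, V$ (total mass less than $1$ is allowed), topologized as a subspace of the function space from $\mathcal O(D)$ to $[0,1]$ (the topology of sequentially open sets for continuous convergence: $\nu_n \to \nu$ iff $\nu_n(U_n) \to \nu(U)$ in $[0,1]$ whenever $U_n \to U$ in $\mathcal O(D)$). For $h : D \to [0,1]$ let $\int h \, d\mu$ be the supremum of $\sum_i a_i\, \mu(U_i)$ over the finite step functions $\sum_i a_i 1_{U_i} \le h$ with $a_i \ge 0$ and $U_i$ open. Then each $P(D)$ is again a countably based topological predomain, and the formulas \[ \mathrm{ret}(x)(U)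 = 1_U(x), \qquad (\mu \gg\!\!= f)(U) = \int f(\cdot)(U)\, d\mu \] define, for all objects $D$, $E$ and every continuous $f : D \to P(E)$, continuous maps $\mathrm{ret} : D \to P(D)$ and $(-) \gg\!\!= f : P(D) \to P(E)$ satisfying the monad laws $\mathrm{ret}(x) \gg\!\!= f = f(x)$, $\mu \gg\!\!= \mathrm{ret} = \mu$ and $(\mu \gg\!\!= f) \gg\!\!= g = \mu \gg\!\!= (x \mapsto f(x) \gg\!\!= g)$. Thus $(P, \mathrm{ret}, \gg\!\!=)$ is a monad on $\mathbf{TP}_\omega$, and the action of its functor on a continuous map $f : D \to E$ is the pushforward $\mu \mapsto \mu \circ f^{-1}$. -/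

import Mathlib

open CategoryTheory Topology TopologicalSpace Filter
open scoped NNReal ENNReal unitInterval

universe u

/-! ## Countably based topological predomains -/

/-- A `qcb₀` space: a `T₀` quotient of a countably based space. -/
def IsQCB₀ (X : Type u) [TopologicalSpace X] : Prop :=
  T0Space X ∧ ∃ (A : Type u) (_ : TopologicalSpace A), SecondCountableTopology A ∧
    ∃ q : A → X, IsQuotientMap q

/-- The information order of a space: `x ⊑ y` if every open set containing `x` contains `y`. -/
def InfoLE {X : Type u} [TopologicalSpace X] (x y : X) : Prop :=
  ∀ U : Opens X, x ∈ U → y ∈ U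

/-- A topological predomain: a `qcb₀` space in which every ascending sequence (in the information
order) has an upper bound to which it converges. -/
def IsTopologicalPredomain (X : Type u) [TopologicalSpace X] : Prop :=
  IsQCB₀ X ∧ ∀ x : ℕ → X, (∀ i, InfoLE (x i) (x (i + 1))) →
    ∃ y, (∀ i, InfoLE (x i) y) ∧ Tendsto x atTop (𝓝 y)

/-- The property of being a countably based topological predomain. -/
def isTPω : ObjectProperty TopCat.{u} :=
  fun X => SecondCountableTopology X ∧ IsTopologicalPredomain X

/-- The category of countably based topological predomains and continuous maps. -/
abbrev TPω : Type (u + 1) := isTPω.{u}.FullSubcategory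

/-! ## Function spaces and valuations -/

/-- The function space of sequential spaces (in particular, of `qcb₀` spaces and of topological
predomains): a sequence `fₙ` converges to `f` when it converges continuously, that is, when
`xₙ → x` implies `fₙ xₙ → f x`, and a set is open when it is sequentially open for this
convergence. On sequential spaces `X` it is the sequential coreflection of the compact-open
topology. -/
abbrev functionSpaceTopology (X Y : Type*) [TopologicalSpace X] [TopologicalSpace Y] :
    TopologicalSpace C(X, Y) where
  IsOpen W := ∀ (f : C(X, Y)) (s : ℕ → C(X, Y)),
    (∀ (x : X) (t : ℕ → X), Tendsto t atTop (𝓝 x) →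
      Tendsto (fun n => s n (t n)) atTop (𝓝 (f x))) →
    f ∈ W → ∀ᶠ n in atTop, s n ∈ W
  isOpen_univ := fun _ _ _ _ => Eventually.of_forall fun _ => trivial
  isOpen_inter := fun _ _ hV hW f s hs hf => (hV f s hs hf.1).and (hW f s hs hf.2)
  isOpen_sUnion := fun _ hS f s hs ⟨W, hW, hf⟩ =>
    (hS W hW f s hs hf).mono fun _ hn => ⟨W, hW, hn⟩

/-- The lattice of opens of `X` with its Scott topology. -/
abbrev OpensScott (X : Type u) [TopologicalSpace X] : Type u := WithScott (Opens X)

/-- The unit interval, ordered by `≤`, with its Scott topology; its opens are `∅`, `[0, 1]` and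
the sets `(a, 1]`. -/
abbrev IScott : Type := WithScott I

/-- The value `ν U ∈ [0, 1]` of a map from opens to the unit interval. -/
def massOf {X : Type u} [TopologicalSpace X] (ν : C(OpensScott X, IScott)) (U : Opens X) : ℝ≥0 :=
  unitInterval.toNNReal (WithScott.ofScott (ν (WithScott.toScott U)))

/-- A (continuous) valuation on `X`: a continuous map from the opens of `X` to the unit interval
that is strict and modular. Continuity includes monotonicity. The total mass may be less than 1. -/
def ContValuation (X : Type u) [TopologicalSpace X] : Type u :=
  {ν : C(OpensScott X, IScott) //
    massOf ν ⊥ = 0 ∧ ∀ U V, massOf ν U + massOf ν V = massOf ν (U ⊔ V) + massOf ν (U ⊓ V)}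

namespace ContValuation

variable {X : Type u} [TopologicalSpace X]

/-- Valuations form a subspace of the function space from opens to the unit interval. -/
instance : TopologicalSpace (ContValuation X) :=
  (functionSpaceTopology (OpensScott X) IScott).induced Subtype.val

/-- The mass `ν U` of an open set `U`. -/
def mass (ν : ContValuation X) (U : Opens X) : ℝ≥0 := massOf ν.1 U

/-- The integral of `h` against the valuation `ν`: the supremum of `∑ aᵢ ν(Uᵢ)` over the finite
step functions on opens `∑ aᵢ 1_{Uᵢ}` that lie below `h`. -/
noncomputable def integral (ν : ContValuation X) (h : X → ℝ≥0) : ℝ≥0∞ :=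
  ⨆ (n : ℕ) (a : Fin n → ℝ≥0) (U : Fin n → Opens X)
    (_ : ∀ x, ∑ i, (U i : Set X).indicator (fun _ => a i) x ≤ h x),
    ((∑ i, a i * ν.mass (U i) : ℝ≥0) : ℝ≥0∞)

end ContValuation

/-! ## Monads as Kleisli triples -/

/-- A monad with object map `T`, given by its unit `ret` and its extension operation `bind`
(`bind f` is `fun μ => μ >>= f`), subject to the three monad laws. -/
structure KleisliTriple {C : Type*} [Category C] (T : C → C) where
  ret : ∀ X : C, X ⟶ T X
  bind : ∀ {X Y : C}, (X ⟶ T Y) → (T X ⟶ T Y)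
  ret_bind : ∀ {X Y : C} (f : X ⟶ T Y), ret X ≫ bind f = f
  bind_ret : ∀ X : C, bind (ret X) = 𝟙 (T X)
  bind_bind : ∀ {X Y Z : C} (f : X ⟶ T Y) (g : Y ⟶ T Z), bind f ≫ bind g = bind (f ≫ bind g)

/-- The monad of a Kleisli triple: `map f = bind (f ≫ ret)`, `η = ret`, `μ = bind 𝟙`. -/
def KleisliTriple.toMonad {C : Type*} [Category C] {T : C → C} (K : KleisliTriple T) :
    CategoryTheory.Monad C where
  obj := T
  map f := K.bind (f ≫ K.ret _)
  map_id X := by rw [Category.id_comp, K.bind_ret]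
  map_comp f g := by simp only [K.bind_bind, Category.assoc, K.ret_bind]
  η := { app := K.ret
         naturality := fun _ _ _ => by simp [K.ret_bind] }
  μ := { app := fun X => K.bind (𝟙 (T X))
         naturality := fun _ _ _ => by simp [K.bind_bind, K.ret_bind] }
  assoc X := by simp [K.bind_bind, K.ret_bind]
  left_unit X := by simp [K.ret_bind]
  right_unit X := by simp [K.bind_bind, K.ret_bind, K.bind_ret]

/-- The extension operation is recovered from the monad. -/
theorem KleisliTriple.toMonad_map_comp_μ {C : Type*} [Category C] {T : C → C}
    (K : KleisliTriple T) {X Y : C} (f : X ⟶ T Y) :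
    K.toMonad.map f ≫ K.toMonad.μ.app Y = K.bind f := by
  simp [KleisliTriple.toMonad, K.bind_bind, K.ret_bind]

/-- The object map `P` of the probability monad: `P D` is the space of valuations on `D`. The
argument `hP` records that this space is again a countably based topological predomain. -/
def probObj (hP : ∀ D : TPω.{u}, isTPω (TopCat.of (ContValuation D.obj))) (D : TPω.{u}) : TPω.{u} :=
  ⟨TopCat.of (ContValuation D.obj), hP D⟩

/-- The function underlying a morphism `D ⟶ P E`. -/
def toValuation {hP : ∀ D : TPω.{u}, isTPω (TopCat.of (ContValuation D.obj))} {D E : TPω.{u}}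
    (f : D ⟶ probObj hP E) (x : D.obj) : ContValuation E.obj :=
  f.hom.hom x

/-- The inverse image of an open set under a morphism. -/
def preimageOpen {D E : TPω.{u}} (f : D ⟶ E) (U : Opens E.obj) : Opens D.obj :=
  U.comap f.hom.hom

/-!
Valuations on a second countable space `X` form a monad for two reasons.

The first concerns the topology. If `Uₙ → U` in the Scott topology of opens, then locally on `U`
almost all `Uₙ` contain a common neighbourhood (`exists_nhds_le_of_tendsto`). Therefore continuous
convergence of functionals on opens means `lim inf νₙ U ≥ ν U` for each single `U`
(`continuousConvergence_of_massOf`): the function space topology is the weak topology. By Scott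
continuity this topology is determined by the masses of finite unions of basic opens
(`functionSpaceTopology_eq_induced`), so it is second countable. Its information order is the
pointwise one, and an ascending sequence converges to its pointwise supremum.

The second concerns the integral. For bounded lower semicontinuous `h` it is the Lebesgue integral
of `t ↦ μ {h > t}` over `t ≥ 0` (`ContValuation.integral_eq_choquet`). In this form Scott
continuity in `h` is the monotone convergence theorem, and modularity of `μ` together with
translation invariance of Lebesgue measure computes the effect of adding a multiple of an indicator
(`ContValuation.choquet_add_indicator`). Uniform approximation by step functions then yields
linearity (`ContValuation.choquet_add_mul`), so that `μ >>= f` is a valuation, and the formula for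
iterated integration (`ContValuation.choquet_bind`), which is associativity of the extension
operation. The supremum formula shows that the integral is lower semicontinuous in `μ`, that is,
that the extension operation is continuous.
-/

/-! ### The Scott topologies on the unit interval and on open sets -/

lemma isOpen_withScott_iff {α : Type*} [Preorder α] {W : Set (WithScott α)} :
    IsOpen W ↔ IsUpperSet W ∧ DirSupInacc W := by
  rw [Topology.IsScott.isOpen_iff_isUpperSet_and_dirSupInaccOn (D := Set.univ), dirSupInaccOn_univ]

namespace IScott

/-- The value of a point of `[0, 1]` as a nonnegative real. -/
def val (x : IScott) : ℝ≥0 := unitInterval.toNNReal (WithScott.ofScott x)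

/-- A number `a ≤ 1` as a point of `[0, 1]` with its Scott topology. -/
def mk (a : ℝ≥0) (h : a ≤ 1) : IScott := WithScott.toScott ⟨a, a.2, h⟩

@[simp] lemma val_mk (a : ℝ≥0) (h : a ≤ 1) : val (mk a h) = a := rfl

lemma val_le_one (x : IScott) : val x ≤ 1 := (WithScott.ofScott x).2.2

lemma val_injective : Function.Injective val := by
  intro x y h
  exact Subtype.ext (congrArg NNReal.toReal h)

lemma isOpen_lt_val (a : ℝ≥0) : IsOpen {x : IScott | a < val x} := by
  by_cases ha : a ≤ 1
  · have : {x : IScott | a < val x} = (Set.Iic (mk a ha))ᶜ := by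
      ext x
      simp only [Set.mem_compl_iff, Set.mem_Iic, Set.mem_ofPred_eq]
      rw [← not_le]
      rfl
    rw [this]
    exact isClosed_Iic.isOpen_compl
  · convert isOpen_empty
    ext x
    simpa using (val_le_one x).trans (not_le.1 ha).le

/-- Around a point `x ≠ 0` the sets `(a, 1]` with `a < x` form a neighbourhood basis; the only
neighbourhood of `0` is the whole interval. -/
lemma exists_lt_subset {W : Set IScott} (hW : IsOpen W) {x : IScott} (hx : x ∈ W) :
    W = Set.univ ∨ ∃ a < val x, {y | a < val y} ⊆ W := by
  obtain ⟨hup, hdir⟩ := isOpen_withScott_iff.1 hW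
  by_cases h0 : val x = 0
  · left
    refine Set.eq_univ_of_forall fun y => hup (a := x) ?_ hx
    change val x ≤ val y
    simp [h0]
  · right
    have hpos : 0 < val x := pos_iff_ne_zero.2 h0
    have hlub : IsLUB {y : IScott | val y < val x} x := by
      refine ⟨fun y (hy : val y < val x) => hy.le, fun y hy => ?_⟩
      change val x ≤ val y
      refine le_of_forall_lt fun a ha => ?_
      obtain ⟨b, hab, hb⟩ := exists_between ha
      exact hab.trans_le (hy (a := mk b (hb.le.trans (val_le_one x))) hb)
    obtain ⟨y, hy, hyW⟩ := hdir (d := {y : IScott | val y < val x}) ⟨mk 0 zero_le_one, hpos⟩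
      (fun y hy z hz => by
        rcases le_total (val y) (val z) with h | h
        · exact ⟨z, hz, h, le_refl (val z)⟩
        · exact ⟨y, hy, le_refl (val y), h⟩) hlub hx
    exact ⟨val y, hy, fun z (hz : val y < val z) => hup (a := y) hz.le hyW⟩

lemma tendsto_nhds_iff {ι : Type*} {l : Filter ι} {s : ι → IScott} {x : IScott} :
    Tendsto s l (𝓝 x) ↔ ∀ a < val x, ∀ᶠ i in l, a < val (s i) := by
  refine ⟨fun h a ha => h ((isOpen_lt_val a).mem_nhds ha), fun h =>
    tendsto_nhds.2 fun W hW hx => ?_⟩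
  rcases exists_lt_subset hW hx with rfl | ⟨a, ha, haW⟩
  · exact univ_mem
  · filter_upwards [h a ha] with i hi using haW hi

lemma continuous_iff {Y : Type*} [TopologicalSpace Y] {f : Y → IScott} :
    Continuous f ↔ LowerSemicontinuous fun y => val (f y) := by
  simp only [continuous_iff_continuousAt, ContinuousAt, tendsto_nhds_iff]
  rfl

instance : SecondCountableTopology IScott := by
  have hb : IsTopologicalBasis
      (insert Set.univ (Set.range fun q : ℚ => {x : IScott | Real.toNNReal q < val x})) := by
    refine isTopologicalBasis_of_isOpen_of_nhds ?_ fun x W hx hW => ?_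
    · rintro _ (rfl | ⟨q, rfl⟩)
      exacts [isOpen_univ, isOpen_lt_val _]
    · rcases exists_lt_subset hW hx with rfl | ⟨a, ha, haW⟩
      · exact ⟨_, Set.mem_insert _ _, hx, subset_rfl⟩
      · obtain ⟨q, -, haq, hq⟩ := (NNReal.lt_iff_exists_rat_btwn _ _).1 ha
        exact ⟨_, Set.mem_insert_of_mem _ ⟨q, rfl⟩, hq, fun y hy => haW (haq.trans hy)⟩
  exact hb.secondCountableTopology ((Set.countable_range _).insert _)

end IScott

section OpensScott

variable {X : Type u} [TopologicalSpace X]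

lemma isOpen_opensScott_iff {W : Set (OpensScott X)} :
    IsOpen W ↔ (∀ U V : Opens X, U ≤ V → WithScott.toScott U ∈ W → WithScott.toScott V ∈ W) ∧
      ∀ d : Set (Opens X), d.Nonempty → DirectedOn (· ≤ ·) d → WithScott.toScott (sSup d) ∈ W →
        ∃ U ∈ d, WithScott.toScott U ∈ W := by
  rw [isOpen_withScott_iff]
  refine ⟨fun ⟨h1, h2⟩ => ⟨fun U V hUV hU => h1 (a := WithScott.toScott U) hUV hU,
    fun d hne hd hs => @h2 d hne hd _
      (isLUB_sSup (α := Opens X) d) hs⟩,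
    fun ⟨h1, h2⟩ => ⟨fun U V hUV hU => h1 U V hUV hU, fun d hne hd b hb hbW => ?_⟩⟩
  have h : b = @sSup (Opens X) _ d := IsLUB.unique (α := Opens X) hb (isLUB_sSup _)
  exact h2 d hne hd (h ▸ hbW)

lemma massOf_mono (ν : C(OpensScott X, IScott)) : Monotone (massOf ν) := fun U V hUV =>
  Topology.IsScott.monotone_of_continuous (D := Set.univ) ν.continuous
    (show WithScott.toScott U ≤ WithScott.toScott V from hUV)

lemma exists_lt_massOf_of_directed (ν : C(OpensScott X, IScott)) {ι : Type*} [Nonempty ι]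
    {U : ι → Opens X} (hU : Directed (· ≤ ·) U) {a : ℝ≥0} (ha : a < massOf ν (⨆ i, U i)) :
    ∃ i, a < massOf ν (U i) := by
  obtain ⟨_, ⟨i, rfl⟩, hi⟩ := (isOpen_opensScott_iff.1
    ((IScott.isOpen_lt_val a).preimage ν.continuous)).2 (Set.range U) (Set.range_nonempty _)
    (directedOn_range.2 hU) ha
  exact ⟨i, hi⟩

/-- On a second countable space, Scott continuity of a functional on opens needs to be checked on
ascending sequences only: a directed union of opens is the union of an ascending sequence from the
family. -/
lemma continuous_of_iSup_nat [SecondCountableTopology X] {F : OpensScott X → IScott}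
    (hmono : Monotone fun U : Opens X => IScott.val (F (WithScott.toScott U)))
    (hsup : ∀ U : ℕ → Opens X, Monotone U → ∀ a < IScott.val (F (WithScott.toScott (⨆ n, U n))),
      ∃ n, a < IScott.val (F (WithScott.toScott (U n)))) :
    Continuous F := by
  rw [IScott.continuous_iff, lowerSemicontinuous_iff_isOpen_preimage]
  intro a
  refine isOpen_opensScott_iff.2 ⟨fun U V hUV hU => lt_of_lt_of_le hU (hmono hUV), ?_⟩
  intro d hne hd had
  obtain ⟨T, hTc, hTs⟩ := isOpen_iUnion_countable (fun i : d => (i.1 : Set X)) fun i => i.1.2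
  -- An enumeration of a countable subfamily with the same union is dominated by an ascending
  -- sequence in `d`.
  obtain ⟨e, he⟩ : ∃ e : ℕ → d, ∀ i ∈ T, ∃ n, e n = i := by
    obtain ⟨p, hp⟩ := hne
    rcases T.eq_empty_or_nonempty with rfl | hT
    · exact ⟨fun _ => ⟨p, hp⟩, by simp⟩
    · obtain ⟨e, he⟩ := hTc.exists_eq_range hT
      exact ⟨e, fun i hi => by rw [he] at hi; exact hi⟩
  choose! j hjd hj1 hj2 using hd
  let V : ℕ → d := fun n =>
    Nat.rec (e 0) (fun n v => ⟨j v (e (n + 1)), hjd _ v.2 _ (e (n + 1)).2⟩) n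
  have hVmono : Monotone fun n => (V n).1 :=
    monotone_nat_of_le_succ fun n => hj1 _ (V n).2 _ (e (n + 1)).2
  have heV : ∀ n, (e n).1 ≤ (V n).1 := by
    intro n
    cases n with
    | zero => exact le_rfl
    | succ n => exact hj2 _ (V n).2 _ (e (n + 1)).2
  have hle : sSup d ≤ ⨆ n, (V n).1 := by
    intro x hx
    obtain ⟨U, hU, hxU⟩ := Opens.mem_sSup.1 hx
    have hx2 : x ∈ ⋃ i : d, (i.1 : Set X) := Set.mem_iUnion.2 ⟨⟨U, hU⟩, hxU⟩
    rw [← hTs] at hx2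
    simp only [Set.mem_iUnion] at hx2
    obtain ⟨i, hi, hxi⟩ := hx2
    obtain ⟨n, rfl⟩ := he i hi
    exact Opens.mem_iSup.2 ⟨n, heV n hxi⟩
  obtain ⟨n, hn⟩ := hsup _ hVmono a (lt_of_lt_of_le had (hmono hle))
  exact ⟨_, (V n).2, hn⟩

/-- If `Uₙ → U` in the Scott topology of opens and `x ∈ U`, then almost all `Uₙ` contain a common
neighbourhood of `x`. Otherwise there would be points `xₖ → x` with `xₖ ∉ U_{nₖ}` and `nₖ → ∞`.
For some `m` the compact set `{x} ∪ {xₖ | k ≥ m}` lies in `U`; the opens that contain it form a Scott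
open set, so it lies in almost all `Uₙ`, a contradiction. -/
lemma exists_nhds_le_of_tendsto [FirstCountableTopology X] {U : ℕ → OpensScott X} {U₀ : OpensScott X}
    (hU : Tendsto U atTop (𝓝 U₀)) {x : X} (hx : x ∈ (WithScott.ofScott U₀ : Opens X)) :
    ∃ N, ∃ V : Opens X, x ∈ V ∧ ∀ n ≥ N, V ≤ WithScott.ofScott (U n) := by
  by_contra! hcon
  obtain ⟨B, hB⟩ := (𝓝 x).exists_antitone_basis
  have hsel : ∀ k, ∃ n ≥ k, ∃ y ∈ B k, y ∉ (WithScott.ofScott (U n) : Opens X) := by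
    intro k
    obtain ⟨n, hn, hV⟩ := hcon k ⟨interior (B k), isOpen_interior⟩
      (mem_interior_iff_mem_nhds.2 (hB.1.mem_of_mem trivial))
    obtain ⟨y, hy, hyU⟩ := SetLike.not_le_iff_exists.1 hV
    exact ⟨n, hn, y, interior_subset hy, hyU⟩
  choose n hn y hyB hyU using hsel
  have hy : Tendsto y atTop (𝓝 x) := hB.tendsto hyB
  obtain ⟨m, hm⟩ := eventually_atTop.1
    (hy ((WithScott.ofScott U₀ : Opens X).isOpen.mem_nhds hx))
  have hK : IsCompact (insert x (Set.range fun k => y (k + m))) :=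
    ((tendsto_add_atTop_iff_nat m).2 hy).isCompact_insert_range
  have hopen : IsOpen {V : OpensScott X | insert x (Set.range fun k => y (k + m)) ⊆
      ((WithScott.ofScott V : Opens X) : Set X)} := by
    refine isOpen_opensScott_iff.2 ⟨fun V W hVW hV => Set.Subset.trans hV hVW, ?_⟩
    intro d hne hd hKd
    have : Nonempty d := hne.to_subtype
    obtain ⟨i, hi⟩ := hK.elim_directed_cover (fun i : d => (i.1 : Set X)) (fun i => i.1.2)
      (by
        have h : (sSup d : Opens X) = ⨆ i : d, i.1 := sSup_eq_iSup' d
        rw [← Opens.coe_iSup, ← h]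
        exact hKd)
      hd.directed_val
    exact ⟨i.1, i.2, hi⟩
  have hmem : ∀ᶠ k in atTop, insert x (Set.range fun k => y (k + m)) ⊆
      ((WithScott.ofScott (U k) : Opens X) : Set X) := by
    refine hU (hopen.mem_nhds ?_)
    rintro z (rfl | ⟨k, rfl⟩)
    exacts [hx, hm _ (Nat.le_add_left _ _)]
  obtain ⟨N, hN⟩ := eventually_atTop.1 hmem
  refine hyU (N + m) (hN _ ((Nat.le_add_right N m).trans (hn _)) (Or.inr ⟨N, rfl⟩))

/-! ### The topology on the function space -/

/-- Continuous convergence of functionals on opens is convergence of the lower bounds of their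
values at each single open set. -/
lemma continuousConvergence_of_massOf [SecondCountableTopology X] {f : C(OpensScott X, IScott)}
    {s : ℕ → C(OpensScott X, IScott)}
    (h : ∀ U, ∀ a < massOf f U, ∀ᶠ n in atTop, a < massOf (s n) U)
    (U₀ : OpensScott X) (U : ℕ → OpensScott X) (hU : Tendsto U atTop (𝓝 U₀)) :
    Tendsto (fun n => s n (U n)) atTop (𝓝 (f U₀)) := by
  rw [IScott.tendsto_nhds_iff]
  intro a ha
  -- `W N` is the interior of the intersection of the `U n` with `n ≥ N`.
  let S : ℕ → Set (Opens X) := fun N => {V | ∀ n ≥ N, V ≤ WithScott.ofScott (U n)}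
  let W : ℕ → Opens X := fun N => sSup (S N)
  have hW : Monotone W := fun M N hMN => sSup_le_sSup fun V hV n hn => hV n (hMN.trans hn)
  have hle : (WithScott.ofScott U₀ : Opens X) ≤ ⨆ N, W N := by
    intro x hx
    obtain ⟨N, V, hxV, hV⟩ := exists_nhds_le_of_tendsto hU hx
    exact Opens.mem_iSup.2 ⟨N, (le_sSup (show V ∈ S N from hV)) hxV⟩
  obtain ⟨N, hN⟩ := exists_lt_massOf_of_directed f hW.directed_le
    (lt_of_lt_of_le ha (massOf_mono f hle))
  filter_upwards [h _ a hN, eventually_ge_atTop N] with n hn hNn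
  exact hn.trans_le (massOf_mono (s n) (sSup_le fun V hV => hV n hNn))

/-- Finite unions of members of a countable basis. -/
def basicUnion (X : Type u) [TopologicalSpace X] [SecondCountableTopology X]
    (s : Finset (countableBasis X)) : Opens X :=
  ⨆ b ∈ s, ⟨b.1, isOpen_of_mem_countableBasis b.2⟩

lemma exists_basicUnion_lt_massOf [SecondCountableTopology X] (ν : C(OpensScott X, IScott))
    {U : Opens X} {a : ℝ≥0} (ha : a < massOf ν U) :
    ∃ s, basicUnion X s ≤ U ∧ a < massOf ν (basicUnion X s) := by
  classical
  let ι := {s : Finset (countableBasis X) // basicUnion X s ≤ U}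
  have : Nonempty ι := ⟨∅, by simp [basicUnion]⟩
  have hdir : Directed (· ≤ ·) fun s : ι => basicUnion X s.1 := by
    rintro ⟨s, hs⟩ ⟨t, ht⟩
    have hst : basicUnion X (s ∪ t) = basicUnion X s ⊔ basicUnion X t := by
      simp only [basicUnion, Finset.mem_union, iSup_or, iSup_sup_eq]
    refine ⟨⟨s ∪ t, by rw [hst]; exact sup_le hs ht⟩, ?_, ?_⟩
    · simp only [hst]; exact le_sup_left
    · simp only [hst]; exact le_sup_right
  have hU : U ≤ ⨆ s : ι, basicUnion X s.1 := by
    intro x hx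
    obtain ⟨b, hb, hxb, hbU⟩ :=
      (isBasis_countableBasis X).exists_subset_of_mem_open (show x ∈ (U : Set X) from hx) U.isOpen
    have hs : basicUnion X {⟨b, hb⟩} = ⟨b, isOpen_of_mem_countableBasis hb⟩ := by
      simp [basicUnion]
    refine Opens.mem_iSup.2 ⟨⟨{⟨b, hb⟩}, by rw [hs]; exact hbU⟩, ?_⟩
    simp only [hs]
    exact hxb
  obtain ⟨s, hs⟩ := exists_lt_massOf_of_directed ν hdir (ha.trans_le (massOf_mono ν hU))
  exact ⟨s.1, s.2, hs⟩

/-- The values of a functional at the finite unions of basic opens. -/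
def basicValues (X : Type u) [TopologicalSpace X] [SecondCountableTopology X]
    (f : C(OpensScott X, IScott)) (s : Finset (countableBasis X)) : IScott :=
  f (WithScott.toScott (basicUnion X s))

lemma tendsto_basicValues_iff [SecondCountableTopology X] {ι : Type*} {l : Filter ι}
    {s : ι → C(OpensScott X, IScott)} {f : C(OpensScott X, IScott)} :
    Tendsto (fun i => basicValues X (s i)) l (𝓝 (basicValues X f)) ↔
      ∀ U, ∀ a < massOf f U, ∀ᶠ i in l, a < massOf (s i) U := by
  simp only [tendsto_pi_nhds, IScott.tendsto_nhds_iff]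
  refine ⟨fun h U a ha => ?_, fun h t a ha => h _ a ha⟩
  obtain ⟨t, ht, hat⟩ := exists_basicUnion_lt_massOf f ha
  exact (h t a hat).mono fun i hi => lt_of_lt_of_le hi (massOf_mono (s i) ht)

/-- The function space from opens to the unit interval carries the weak topology, which is second
countable since the values at finite unions of basic opens determine it. -/
lemma functionSpaceTopology_eq_induced [SecondCountableTopology X] :
    functionSpaceTopology (OpensScott X) IScott =
      TopologicalSpace.induced (basicValues X) inferInstance := by
  refine TopologicalSpace.ext_iff.2 fun W => ⟨fun hW => ?_, fun hW f s hs hf => ?_⟩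
  · rw [@isOpen_iff_mem_nhds _ (TopologicalSpace.induced (basicValues X) inferInstance)]
    intro f hf
    rw [nhds_induced]
    refine eventually_iff_seq_eventually.2 fun s hs => hW f s (fun U₀ U hU => ?_) hf
    exact continuousConvergence_of_massOf
      (tendsto_basicValues_iff.1 (tendsto_comap_iff.1 hs)) U₀ U hU
  · have : Tendsto s atTop (comap (basicValues X) (𝓝 (basicValues X f))) :=
      tendsto_comap_iff.2 (tendsto_basicValues_iff.2 fun U a ha =>
        IScott.tendsto_nhds_iff.1 (hs _ (fun _ => WithScott.toScott U) tendsto_const_nhds) a ha)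
    rw [← nhds_induced] at this
    exact this ((@isOpen_iff_mem_nhds _
      (TopologicalSpace.induced (basicValues X) inferInstance) _).1 hW f hf)

end OpensScott

/-! ### The space of valuations -/

namespace ContValuation

variable {X : Type u} [TopologicalSpace X]

lemma mass_le_one (ν : ContValuation X) (U : Opens X) : ν.mass U ≤ 1 := IScott.val_le_one _

lemma mass_mono (ν : ContValuation X) : Monotone ν.mass := massOf_mono ν.1

@[simp] lemma mass_bot (ν : ContValuation X) : ν.mass ⊥ = 0 := ν.2.1

lemma mass_modular (ν : ContValuation X) (U V : Opens X) :
    ν.mass U + ν.mass V = ν.mass (U ⊔ V) + ν.mass (U ⊓ V) := ν.2.2 U V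

lemma mass_iSup_nat (ν : ContValuation X) {U : ℕ → Opens X} (hU : Monotone U) :
    (ν.mass (⨆ n, U n) : ℝ≥0∞) = ⨆ n, (ν.mass (U n) : ℝ≥0∞) := by
  refine le_antisymm (ENNReal.le_of_forall_nnreal_lt fun a ha => ?_)
    (iSup_le fun n => ENNReal.coe_le_coe.2 (ν.mass_mono (le_iSup U n)))
  obtain ⟨n, hn⟩ := exists_lt_massOf_of_directed ν.1 hU.directed_le (ENNReal.coe_lt_coe.1 ha)
  exact le_iSup_of_le n (ENNReal.coe_le_coe.2 hn.le)

@[ext] lemma ext {μ ν : ContValuation X} (h : ∀ U, μ.mass U = ν.mass U) : μ = ν :=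
  Subtype.ext (ContinuousMap.ext fun U => IScott.val_injective (h U))

/-- A valuation on a second countable space from its values, with continuity tested on ascending
sequences of opens. -/
def ofMass [SecondCountableTopology X] (m : Opens X → ℝ≥0) (h1 : ∀ U, m U ≤ 1) (hmono : Monotone m)
    (hsup : ∀ U : ℕ → Opens X, Monotone U → ∀ a < m (⨆ n, U n), ∃ n, a < m (U n))
    (hbot : m ⊥ = 0) (hmod : ∀ U V, m U + m V = m (U ⊔ V) + m (U ⊓ V)) : ContValuation X :=
  ⟨⟨fun U => IScott.mk (m (WithScott.ofScott U)) (h1 _), continuous_of_iSup_nat hmono hsup⟩,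
    hbot, hmod⟩

lemma topology_eq_induced [SecondCountableTopology X] :
    (inferInstance : TopologicalSpace (ContValuation X)) =
      TopologicalSpace.induced (fun ν => basicValues X ν.1) inferInstance := by
  change TopologicalSpace.induced _ (functionSpaceTopology _ _) = _
  rw [functionSpaceTopology_eq_induced]
  exact induced_compose

instance [SecondCountableTopology X] : SecondCountableTopology (ContValuation X) := by
  have h : IsInducing fun ν : ContValuation X => basicValues X ν.1 := ⟨topology_eq_induced⟩
  exact h.secondCountableTopology

lemma tendsto_nhds_iff [SecondCountableTopology X] {ι : Type*} {l : Filter ι}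
    {s : ι → ContValuation X} {ν : ContValuation X} :
    Tendsto s l (𝓝 ν) ↔ ∀ U, ∀ a < ν.mass U, ∀ᶠ i in l, a < (s i).mass U := by
  have h : IsInducing fun ν : ContValuation X => basicValues X ν.1 := ⟨topology_eq_induced⟩
  rw [h.tendsto_nhds_iff]
  exact tendsto_basicValues_iff

lemma continuous_iff [SecondCountableTopology X] {Y : Type*} [TopologicalSpace Y]
    {f : Y → ContValuation X} :
    Continuous f ↔ ∀ U, LowerSemicontinuous fun y => (f y).mass U := by
  simp only [continuous_iff_continuousAt, ContinuousAt, tendsto_nhds_iff]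
  exact forall_comm

lemma lowerSemicontinuous_mass [SecondCountableTopology X] (U : Opens X) :
    LowerSemicontinuous fun ν : ContValuation X => ν.mass U :=
  continuous_iff.1 continuous_id U

lemma infoLE_iff [SecondCountableTopology X] {μ ν : ContValuation X} :
    InfoLE μ ν ↔ ∀ U, μ.mass U ≤ ν.mass U := by
  refine ⟨fun h U => le_of_forall_lt fun a ha => ?_, fun h W hW => ?_⟩
  · exact h ⟨_, (lowerSemicontinuous_mass U).isOpen_preimage a⟩ ha
  · have : Tendsto (fun _ : Unit => ν) (pure ()) (𝓝 μ) :=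
      tendsto_nhds_iff.2 fun U a ha => Eventually.of_forall fun _ => ha.trans_le (h U)
    exact this (W.isOpen.mem_nhds hW)

instance [SecondCountableTopology X] : T0Space (ContValuation X) where
  t0 _ _ h := ext fun U => le_antisymm
    (infoLE_iff.1 (fun W hW => (h.mem_open_iff W.isOpen).1 hW) U)
    (infoLE_iff.1 (fun W hW => (h.mem_open_iff W.isOpen).2 hW) U)

/-- An ascending sequence of valuations converges to its pointwise supremum, which is again a
valuation. -/
lemma exists_tendsto_of_monotone [SecondCountableTopology X] {ν : ℕ → ContValuation X}
    (hν : ∀ U, Monotone fun n => (ν n).mass U) :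
    ∃ μ : ContValuation X, (∀ n U, (ν n).mass U ≤ μ.mass U) ∧ Tendsto ν atTop (𝓝 μ) := by
  have hbdd : ∀ U, BddAbove (Set.range fun n => (ν n).mass U) := fun U =>
    ⟨1, by rintro _ ⟨n, rfl⟩; exact (ν n).mass_le_one U⟩
  have hlim : ∀ U, Tendsto (fun n => (ν n).mass U) atTop (𝓝 (⨆ n, (ν n).mass U)) := fun U =>
    tendsto_atTop_ciSup (hν U) (hbdd U)
  have hmono : Monotone fun U => ⨆ n, (ν n).mass U := fun U V hUV =>
    ciSup_mono (hbdd V) fun n => (ν n).mass_mono hUV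
  refine ⟨ofMass (fun U => ⨆ n, (ν n).mass U) (fun U => ciSup_le fun n => (ν n).mass_le_one U) hmono
    (fun U hU a ha => ?_) (by simp) (fun U V => ?_), fun n U => le_ciSup (hbdd U) n, ?_⟩
  · obtain ⟨n, hn⟩ := exists_lt_of_lt_ciSup ha
    obtain ⟨k, hk⟩ := exists_lt_massOf_of_directed (ν n).1 hU.directed_le hn
    exact ⟨k, hk.trans_le (le_ciSup (hbdd (U k)) n)⟩
  · refine tendsto_nhds_unique ((hlim U).add (hlim V)) ?_
    simpa only [← mass_modular] using (hlim (U ⊔ V)).add (hlim (U ⊓ V))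
  · rw [tendsto_nhds_iff]
    intro U a ha
    exact (hlim U).eventually (lt_mem_nhds ha)

theorem isTPω_of_secondCountable [SecondCountableTopology X] :
    isTPω (TopCat.of (ContValuation X)) := by
  refine ⟨inferInstanceAs (SecondCountableTopology (ContValuation X)),
    ⟨inferInstanceAs (T0Space (ContValuation X)), ContValuation X, inferInstance, inferInstance, id,
      IsQuotientMap.id⟩, fun (ν : ℕ → ContValuation X) hν => ?_⟩
  obtain ⟨μ, hle, hlim⟩ := exists_tendsto_of_monotone (ν := ν)
    fun U => monotone_nat_of_le_succ fun n => infoLE_iff.1 (hν n) U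
  exact ⟨μ, fun i => infoLE_iff.2 (hle i), hlim⟩

end ContValuation

/-! ### Integration against a valuation -/

namespace ContValuation

open MeasureTheory

variable {X : Type u} [TopologicalSpace X]

/-- The superlevel set `{h > t}`, an open set when `h` is lower semicontinuous. Its interior is
taken so that it is defined for every `h`. -/
def superlevel (h : X → ℝ≥0) (t : ℝ) : Opens X := Opens.interior {x | t < h x}

lemma mem_superlevel {h : X → ℝ≥0} (hh : LowerSemicontinuous h) {t : ℝ} {x : X} :
    x ∈ superlevel h t ↔ t < h x := by
  have ho : IsOpen {x | t < h x} := (lowerSemicontinuous_iff_isOpen_preimage.1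
    (NNReal.continuous_coe.comp_lowerSemicontinuous hh NNReal.coe_mono)) t
  change x ∈ interior {x | t < (h x : ℝ)} ↔ _
  rw [ho.interior_eq]
  rfl

lemma superlevel_antitone (h : X → ℝ≥0) : Antitone (superlevel h) := fun _ _ hst =>
  interior_mono fun _ hx => lt_of_le_of_lt hst hx

/-- The Choquet integral `∫₀^∞ μ {h > t} dt`. It is additive, and agrees with
`ContValuation.integral`, on bounded lower semicontinuous functions. -/
noncomputable def choquet (μ : ContValuation X) (h : X → ℝ≥0) : ℝ≥0∞ :=
  ∫⁻ t in Set.Ici (0 : ℝ), μ.mass (superlevel h t)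

variable (μ : ContValuation X)

lemma measurable_mass_superlevel_inf (h : X → ℝ≥0) (U : Opens X) :
    Measurable fun t : ℝ => (μ.mass (superlevel h t ⊓ U) : ℝ≥0∞) :=
  Antitone.measurable fun _ _ hst =>
    ENNReal.coe_le_coe.2 (μ.mass_mono (inf_le_inf_right U (superlevel_antitone h hst)))

lemma measurable_mass_superlevel (h : X → ℝ≥0) :
    Measurable fun t : ℝ => (μ.mass (superlevel h t) : ℝ≥0∞) := by
  simpa using μ.measurable_mass_superlevel_inf h ⊤

lemma choquet_mono {g h : X → ℝ≥0} (hgh : ∀ x, g x ≤ h x) : μ.choquet g ≤ μ.choquet h :=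
  lintegral_mono fun _ => ENNReal.coe_le_coe.2 (μ.mass_mono
    (interior_mono fun x hx => lt_of_lt_of_le hx (NNReal.coe_le_coe.2 (hgh x))))

lemma choquet_le {h : X → ℝ≥0} {M : ℝ≥0} (hM : ∀ x, h x ≤ M) : μ.choquet h ≤ M := by
  have hle : ∀ t : ℝ, (μ.mass (superlevel h t) : ℝ≥0∞) ≤ (Set.Iio (M : ℝ)).indicator 1 t := by
    intro t
    by_cases ht : t < M
    · rw [Set.indicator_of_mem (show t ∈ Set.Iio (M : ℝ) from ht)]
      exact ENNReal.coe_le_one_iff.2 (μ.mass_le_one _)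
    · have : superlevel h t = ⊥ := by
        refine le_bot_iff.1 fun x hx => ht ?_
        have hx' : x ∈ {x | t < (h x : ℝ)} := interior_subset (s := {x | t < (h x : ℝ)}) hx
        exact lt_of_lt_of_le hx' (NNReal.coe_le_coe.2 (hM x))
      simp [this]
  calc μ.choquet h ≤ ∫⁻ t in Set.Ici (0 : ℝ), (Set.Iio (M : ℝ)).indicator 1 t :=
        lintegral_mono hle
    _ = volume (Set.Ico 0 (M : ℝ)) := by
        rw [lintegral_indicator_one measurableSet_Iio, Measure.restrict_apply measurableSet_Iio,
          Set.inter_comm, Set.Ici_inter_Iio]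
    _ = M := by simp [Real.volume_Ico]

@[simp] lemma choquet_zero : μ.choquet (fun _ => 0) = 0 :=
  le_antisymm (by simpa using μ.choquet_le (h := fun _ => 0) (M := 0) fun _ => le_rfl) zero_le

lemma lowerSemicontinuous_indicator (U : Opens X) (a : ℝ≥0) :
    LowerSemicontinuous ((U : Set X).indicator fun _ => a) :=
  U.isOpen.lowerSemicontinuous_indicator zero_le

/-- Adding a multiple of the indicator of an open set. Since
`{g + a 1_U > t} = {g > t} ∪ ({g > t - a} ∩ U)`, modularity expresses `μ {g + a 1_U > t}` by
`μ {g > t}` and the difference of the values of `μ {g > · } ∩ U` at `t - a` and `t`; the integral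
over `t ≥ 0` of this difference telescopes to `a * μ U`. -/
lemma choquet_add_indicator {g : X → ℝ≥0} (hg : LowerSemicontinuous g) {M : ℝ≥0}
    (hM : ∀ x, g x ≤ M) (a : ℝ≥0) (U : Opens X) :
    μ.choquet (fun x => g x + (U : Set X).indicator (fun _ => a) x) =
      μ.choquet g + a * μ.mass U := by
  have hlsc := hg.add (lowerSemicontinuous_indicator U a)
  let F : ℝ → ℝ≥0∞ := fun t => μ.mass (superlevel g t ⊓ U)
  have hF : Measurable F := μ.measurable_mass_superlevel_inf g U
  have hmod : ∀ t : ℝ, (μ.mass (superlevel (fun x => g x + (U : Set X).indicator (fun _ => a) x) t)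
      : ℝ≥0∞) + F t = μ.mass (superlevel g t) + F (t - a) := by
    intro t
    have h1 : superlevel (fun x => g x + (U : Set X).indicator (fun _ => a) x) t =
        superlevel g t ⊔ (superlevel g (t - a) ⊓ U) := by
      ext x
      simp only [SetLike.mem_coe, Opens.mem_sup, Opens.mem_inf, mem_superlevel hlsc,
        mem_superlevel hg]
      by_cases hx : x ∈ U
      · rw [Set.indicator_of_mem (show x ∈ (U : Set X) from hx)]
        have := a.coe_nonneg
        push_cast
        constructor
        · intro h; exact Or.inr ⟨by linarith, hx⟩
        · rintro (h | ⟨h, -⟩) <;> linarith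
      · rw [Set.indicator_of_notMem (show x ∉ (U : Set X) from hx)]
        simp [hx]
    have h2 : superlevel g t ⊓ (superlevel g (t - a) ⊓ U) = superlevel g t ⊓ U := by
      rw [← inf_assoc, inf_eq_left.2 (superlevel_antitone g (by simp))]
    rw [h1]
    have := μ.mass_modular (superlevel g t) (superlevel g (t - a) ⊓ U)
    rw [h2] at this
    simp only [F]
    exact_mod_cast this.symm
  have hshift : ∫⁻ t in Set.Ici (0 : ℝ), F (t - a) =
      a * μ.mass U + ∫⁻ t in Set.Ici (0 : ℝ), F t := by
    have hpre : (fun t : ℝ => t - a) ⁻¹' Set.Ici (-(a : ℝ)) = Set.Ici 0 := by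
      ext t; simp
    have h3 := (measurePreserving_sub_right volume (a : ℝ)).setLIntegral_comp_preimage
      (measurableSet_Ici (a := -(a : ℝ))) hF
    rw [hpre] at h3
    have h4 : ∫⁻ t in Set.Ico (-(a : ℝ)) 0, F t = a * μ.mass U := by
      have : ∀ t ∈ Set.Ico (-(a : ℝ)) 0, F t = μ.mass U := by
        intro t ht
        have : superlevel g t ⊓ U = U := inf_eq_right.2 fun x _ =>
          (mem_superlevel hg).2 (ht.2.trans_le (g x).coe_nonneg)
        simp only [F, this]
      rw [setLIntegral_congr_fun measurableSet_Ico this, setLIntegral_const, Real.volume_Ico]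
      simp [mul_comm]
    rw [h3, ← Set.Ico_union_Ici_eq_Ici (show -(a : ℝ) ≤ 0 by simp),
      lintegral_union measurableSet_Ici, h4]
    exact Set.disjoint_left.2 fun t ht ht' => not_le.2 ht.2 ht'
  have hfin : ∫⁻ t in Set.Ici (0 : ℝ), F t ≠ ∞ := by
    refine ne_top_of_le_ne_top ENNReal.coe_ne_top
      (le_trans (lintegral_mono fun t => ?_) (μ.choquet_le hM))
    exact ENNReal.coe_le_coe.2 (μ.mass_mono inf_le_left)
  -- Cancellation of the integral of `F` needs `g` to be bounded.
  refine (ENNReal.add_left_inj hfin).1 ?_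
  rw [choquet, choquet, ← lintegral_add_left (μ.measurable_mass_superlevel _),
    lintegral_congr hmod, lintegral_add_left (μ.measurable_mass_superlevel _), hshift, add_assoc]

/-- The step function `∑ aᵢ 1_{Uᵢ}` on opens. -/
noncomputable def step {n : ℕ} (a : Fin n → ℝ≥0) (U : Fin n → Opens X) (x : X) : ℝ≥0 :=
  ∑ i, (U i : Set X).indicator (fun _ => a i) x

lemma lowerSemicontinuous_const_mul {f : X → ℝ≥0} (hf : LowerSemicontinuous f) (c : ℝ≥0) :
    LowerSemicontinuous fun x => c * f x :=
  (continuous_const_mul c).comp_lowerSemicontinuous hf fun _ _ h => mul_le_mul_right h c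

lemma lowerSemicontinuous_step {n : ℕ} (a : Fin n → ℝ≥0) (U : Fin n → Opens X) :
    LowerSemicontinuous (step a U) :=
  lowerSemicontinuous_sum fun i _ => lowerSemicontinuous_indicator (U i) (a i)

lemma step_le {n : ℕ} (a : Fin n → ℝ≥0) (U : Fin n → Opens X) (x : X) :
    step a U x ≤ ∑ i, a i :=
  Finset.sum_le_sum fun _ _ => Set.indicator_le_self' (fun _ _ => zero_le) x

lemma choquet_add_mul_step {g : X → ℝ≥0} (hg : LowerSemicontinuous g) {M : ℝ≥0}
    (hM : ∀ x, g x ≤ M) (c : ℝ≥0) {n : ℕ} (a : Fin n → ℝ≥0) (U : Fin n → Opens X) :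
    μ.choquet (fun x => g x + c * step a U x) =
      μ.choquet g + c * ∑ i, (a i : ℝ≥0∞) * μ.mass (U i) := by
  induction n with
  | zero => simp [step]
  | succ n ih =>
    have h1 : (fun x => g x + c * step a U x) = fun x =>
        (g x + c * step (fun i => a i.castSucc) (fun i => U i.castSucc) x) +
          (U (Fin.last n) : Set X).indicator (fun _ => c * a (Fin.last n)) x := by
      funext x
      have h2 : (U (Fin.last n) : Set X).indicator (fun _ => c * a (Fin.last n)) x =
          c * (U (Fin.last n) : Set X).indicator (fun _ => a (Fin.last n)) x := by
        by_cases hx : x ∈ (U (Fin.last n) : Set X) <;> simp [Set.indicator, hx]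
      rw [h2]
      simp only [step, Fin.sum_univ_castSucc]
      ring
    rw [h1, choquet_add_indicator (M := M + c * ∑ i : Fin n, a i.castSucc) _
      (hg.add (lowerSemicontinuous_const_mul (lowerSemicontinuous_step _ _) c))
      (fun x => add_le_add (hM x) (mul_le_mul_right (step_le _ _ x) c)), ih,
      Fin.sum_univ_castSucc]
    push_cast
    ring

lemma choquet_step {n : ℕ} (a : Fin n → ℝ≥0) (U : Fin n → Opens X) :
    μ.choquet (step a U) = ∑ i, (a i : ℝ≥0∞) * μ.mass (U i) := by
  simpa using μ.choquet_add_mul_step (g := fun _ => 0) lowerSemicontinuous_const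
    (M := 0) (fun _ => le_rfl) 1 a U

lemma choquet_indicator_one (U : Opens X) :
    μ.choquet ((U : Set X).indicator fun _ => 1) = μ.mass U := by
  simpa using μ.choquet_add_indicator (g := fun _ => 0) lowerSemicontinuous_const
    (M := 0) (fun _ => le_rfl) 1 U

lemma choquet_add_const_le {g : X → ℝ≥0} (hg : LowerSemicontinuous g) {M : ℝ≥0}
    (hM : ∀ x, g x ≤ M) (ε : ℝ≥0) : μ.choquet (fun x => g x + ε) ≤ μ.choquet g + ε := by
  have h := μ.choquet_add_indicator hg hM ε ⊤
  simp only [Opens.coe_top, Set.indicator_univ] at h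
  rw [h]
  gcongr
  exact mul_le_of_le_one_right' (by exact_mod_cast μ.mass_le_one ⊤)

/-- Uniform approximation from below of lower semicontinuous functions with values in `[0, 1]` by
step functions: with `n ≥ 1/ε`, take `1/n` on each of the sets `{h > k/n}`, `k = 1, …, n`. -/
lemma exists_step_le {h : X → ℝ≥0} (hh : LowerSemicontinuous h) (h1 : ∀ x, h x ≤ 1) {ε : ℝ≥0}
    (hε : 0 < ε) : ∃ (n : ℕ) (a : Fin n → ℝ≥0) (U : Fin n → Opens X),
      (∀ x, step a U x ≤ h x) ∧ ∀ x, h x ≤ step a U x + ε := by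
  obtain ⟨m, hm⟩ := exists_nat_gt (ε⁻¹)
  have hm0 : (0 : ℝ≥0) < m := (inv_pos.2 hε).trans hm
  have hmε : (m : ℝ≥0)⁻¹ ≤ ε := inv_le_of_inv_le₀ hε hm.le
  let U : Fin m → Opens X := fun k => superlevel h ((k + 1 : ℝ) / m)
  have hstep : ∀ x, step (fun _ => (m : ℝ≥0)⁻¹) U x =
      ((Finset.range m).filter fun k : ℕ => ((k + 1 : ℕ) : ℝ≥0) < m * h x).card * (m : ℝ≥0)⁻¹ := by
    intro x
    have hmem : ∀ k : Fin m, (U k : Set X).indicator (fun _ => (m : ℝ≥0)⁻¹) x =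
        if ((k + 1 : ℕ) : ℝ≥0) < m * h x then (m : ℝ≥0)⁻¹ else 0 := by
      intro k
      have : x ∈ (U k : Set X) ↔ ((k + 1 : ℕ) : ℝ≥0) < m * h x := by
        rw [SetLike.mem_coe, mem_superlevel hh, div_lt_iff₀' (by exact_mod_cast hm0),
          ← NNReal.coe_lt_coe]
        push_cast
        rfl
      simp only [Set.indicator, this]
    simp only [step, hmem]
    rw [Fin.sum_univ_eq_sum_range
      (fun k : ℕ => if ((k + 1 : ℕ) : ℝ≥0) < m * h x then (m : ℝ≥0)⁻¹ else 0),
      ← Finset.sum_filter, Finset.sum_const, nsmul_eq_mul]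
  refine ⟨m, fun _ => (m : ℝ≥0)⁻¹, U, fun x => ?_, fun x => ?_⟩
  · rw [hstep, ← div_eq_mul_inv, div_le_iff₀' hm0]
    have hsub : ((Finset.range m).filter fun k : ℕ => ((k + 1 : ℕ) : ℝ≥0) < m * h x) ⊆
        Finset.range ⌊m * h x⌋₊ := fun k hk =>
      Finset.mem_range.2 (Nat.le_floor (Finset.mem_filter.1 hk).2.le)
    exact (Nat.cast_le.2 ((Finset.card_le_card hsub).trans_eq (Finset.card_range _))).trans
      (Nat.floor_le zero_le)
  · rw [hstep]
    have hsub : Finset.range (⌈m * h x⌉₊ - 1) ⊆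
        (Finset.range m).filter fun k : ℕ => ((k + 1 : ℕ) : ℝ≥0) < m * h x := by
      intro k hk
      have hk' : k + 1 < ⌈m * h x⌉₊ := by
        have := Finset.mem_range.1 hk; omega
      have hle : ⌈m * h x⌉₊ ≤ m := Nat.ceil_le.2 (by simpa using mul_le_mul_right (h1 x) (m : ℝ≥0))
      exact Finset.mem_filter.2 ⟨Finset.mem_range.2 (by omega), Nat.lt_ceil.1 hk'⟩
    have hcard := (Finset.card_range _).symm.trans_le (Finset.card_le_card hsub)
    have hle : (m * h x : ℝ≥0) ≤
        ((Finset.range m).filter fun k : ℕ => ((k + 1 : ℕ) : ℝ≥0) < m * h x).card + 1 := by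
      refine (Nat.le_ceil _).trans ?_
      exact_mod_cast (by omega)
    calc h x = (m * h x) * (m : ℝ≥0)⁻¹ := by field_simp
      _ ≤ _ := mul_le_mul_left hle _
      _ ≤ _ := by rw [add_mul, one_mul]; exact add_le_add_right hmε _

/-- Additivity and homogeneity of the integral, by uniform approximation of `h` by step
functions. -/
lemma choquet_add_mul {g h : X → ℝ≥0} (hg : LowerSemicontinuous g) {M : ℝ≥0} (hM : ∀ x, g x ≤ M)
    (hh : LowerSemicontinuous h) (h1 : ∀ x, h x ≤ 1) (c : ℝ≥0) :
    μ.choquet (fun x => g x + c * h x) = μ.choquet g + c * μ.choquet h := by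
  -- It suffices to bound both sides by each other up to `c * ε`.
  have key : ∀ ε : ℝ≥0, 0 < ε →
      μ.choquet (fun x => g x + c * h x) ≤ μ.choquet g + c * μ.choquet h + c * ε ∧
      μ.choquet g + c * μ.choquet h ≤ μ.choquet (fun x => g x + c * h x) + c * ε := by
    intro ε hε
    obtain ⟨n, a, U, hs1, hs2⟩ := exists_step_le hh h1 hε
    have hgs : μ.choquet (fun x => g x + c * step a U x) =
        μ.choquet g + c * μ.choquet (step a U) := by
      rw [choquet_step, μ.choquet_add_mul_step hg hM]
    constructor
    · calc μ.choquet (fun x => g x + c * h x)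
          ≤ μ.choquet (fun x => (g x + c * step a U x) + c * ε) := μ.choquet_mono fun x => by
            rw [add_assoc, ← mul_add]
            exact add_le_add_right (mul_le_mul_right (hs2 x) c) _
        _ ≤ μ.choquet (fun x => g x + c * step a U x) + (c * ε : ℝ≥0) :=
            μ.choquet_add_const_le
              (hg.add (lowerSemicontinuous_const_mul (lowerSemicontinuous_step a U) c))
              (M := M + c * ∑ i, a i)
              (fun x => add_le_add (hM x) (mul_le_mul_right (step_le a U x) c)) _
        _ ≤ _ := by
            rw [hgs, ENNReal.coe_mul]
            gcongr
            exact μ.choquet_mono hs1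
    · calc μ.choquet g + c * μ.choquet h
          ≤ μ.choquet g + c * (μ.choquet (step a U) + ε) := by
            gcongr
            exact (μ.choquet_mono hs2).trans
              (μ.choquet_add_const_le (lowerSemicontinuous_step a U) (step_le a U) ε)
        _ = μ.choquet (fun x => g x + c * step a U x) + c * ε := by
            rw [hgs, mul_add, add_assoc]
        _ ≤ _ := by
            gcongr
            exact μ.choquet_mono fun x => add_le_add_right (mul_le_mul_right (hs1 x) c) _
  have hlim : ∀ A B : ℝ≥0∞, (∀ ε : ℝ≥0, 0 < ε → A ≤ B + c * ε) → A ≤ B := by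
    intro A B hAB
    refine ENNReal.le_of_forall_pos_le_add fun δ hδ _ => ?_
    refine (hAB (δ / (c + 1)) (by positivity)).trans ?_
    gcongr
    rw [← ENNReal.coe_mul, ENNReal.coe_le_coe, mul_div_assoc', div_le_iff₀ (by positivity), mul_comm]
    gcongr
    exact le_self_add
  exact le_antisymm (hlim _ _ fun ε hε => (key ε hε).1) (hlim _ _ fun ε hε => (key ε hε).2)

lemma choquet_add {g h : X → ℝ≥0} (hg : LowerSemicontinuous g) {M : ℝ≥0} (hM : ∀ x, g x ≤ M)
    (hh : LowerSemicontinuous h) (h1 : ∀ x, h x ≤ 1) :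
    μ.choquet (fun x => g x + h x) = μ.choquet g + μ.choquet h := by
  simpa using μ.choquet_add_mul hg hM hh h1 1

lemma choquet_sum_mul {n : ℕ} {h : Fin n → X → ℝ≥0} (hh : ∀ i, LowerSemicontinuous (h i))
    (h1 : ∀ i x, h i x ≤ 1) (c : Fin n → ℝ≥0) :
    μ.choquet (fun x => ∑ i, c i * h i x) = ∑ i, c i * μ.choquet (h i) := by
  induction n with
  | zero => simp
  | succ n ih =>
    simp only [Fin.sum_univ_castSucc]
    rw [μ.choquet_add_mul (M := ∑ i : Fin n, c i.castSucc * 1)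
      (lowerSemicontinuous_sum fun i _ => lowerSemicontinuous_const_mul (hh _) _)
      (fun x => Finset.sum_le_sum fun i _ => mul_le_mul_right (h1 _ x) _) (hh _) (h1 _),
      ih (fun i => hh _) fun i => h1 _]

/-- Step functions below `h` have integral at most `choquet μ h` by monotonicity, and those that
approximate `h` uniformly come arbitrarily close to it. -/
theorem integral_eq_choquet {h : X → ℝ≥0} (hh : LowerSemicontinuous h) (h1 : ∀ x, h x ≤ 1) :
    μ.integral h = μ.choquet h := by
  refine le_antisymm ?_ (ENNReal.le_of_forall_pos_le_add fun ε hε _ => ?_)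
  · refine iSup_le fun n => iSup_le fun a => iSup_le fun U => iSup_le fun hs => ?_
    have := μ.choquet_step a U
    push_cast
    rw [← this]
    exact μ.choquet_mono hs
  · obtain ⟨n, a, U, hs1, hs2⟩ := exists_step_le hh h1 hε
    refine ((μ.choquet_mono hs2).trans (μ.choquet_add_const_le (lowerSemicontinuous_step a U)
      (step_le a U) ε)).trans (add_le_add_left ?_ _)
    rw [choquet_step]
    refine le_iSup_of_le n (le_iSup_of_le a (le_iSup_of_le U (le_iSup_of_le hs1 ?_)))
    push_cast
    rfl

/-- Monotone convergence: the Choquet integral inherits Scott continuity in the integrand from the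
Scott continuity of the valuation. -/
lemma choquet_eq_iSup {h : X → ℝ≥0} {s : ℕ → X → ℝ≥0} (hh : LowerSemicontinuous h)
    (hs : ∀ n, LowerSemicontinuous (s n)) (hmono : ∀ x, Monotone fun n => s n x)
    (hle : ∀ n x, s n x ≤ h x) (hsup : ∀ x, ∀ a < h x, ∃ n, a < s n x) :
    μ.choquet h = ⨆ n, μ.choquet (s n) := by
  have hm : ∀ t : ℝ, Monotone fun n => superlevel (s n) t := fun t m n hmn x hx =>
    (mem_superlevel (hs n)).2 (((mem_superlevel (hs m)).1 hx).trans_le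
      (NNReal.coe_le_coe.2 (hmono x hmn)))
  simp only [choquet]
  rw [← lintegral_iSup (fun n => μ.measurable_mass_superlevel _)
    fun m n hmn t => ENNReal.coe_le_coe.2 (μ.mass_mono (hm t hmn))]
  refine setLIntegral_congr_fun measurableSet_Ici fun t (ht : 0 ≤ t) => ?_
  rw [← μ.mass_iSup_nat (hm t)]
  congr 2
  ext x
  lift t to ℝ≥0 using ht
  simp only [SetLike.mem_coe, Opens.mem_iSup, mem_superlevel hh, mem_superlevel (hs _),
    NNReal.coe_lt_coe]
  exact ⟨hsup x t, fun ⟨n, hn⟩ => hn.trans_le (hle n x)⟩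

lemma choquet_ne_top {h : X → ℝ≥0} (h1 : ∀ x, h x ≤ 1) : μ.choquet h ≠ ∞ :=
  ne_top_of_le_ne_top ENNReal.coe_ne_top (μ.choquet_le h1)

/-- The integral of a fixed function is a supremum of nonnegative combinations of the masses of
opens, hence lower semicontinuous in the valuation. -/
lemma lowerSemicontinuous_integral [SecondCountableTopology X] (h : X → ℝ≥0) :
    LowerSemicontinuous fun μ : ContValuation X => μ.integral h := by
  refine lowerSemicontinuous_iSup fun n => lowerSemicontinuous_iSup fun a =>
    lowerSemicontinuous_iSup fun U => lowerSemicontinuous_iSup fun _ => ?_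
  exact ENNReal.continuous_coe.comp_lowerSemicontinuous
    (lowerSemicontinuous_sum fun i _ =>
      lowerSemicontinuous_const_mul (lowerSemicontinuous_mass (U i)) (a i)) ENNReal.coe_mono

/-! ### The unit and the extension operation -/

/-- The unit mass at a point. -/
noncomputable def dirac [SecondCountableTopology X] (x : X) : ContValuation X :=
  ofMass (fun U => (U : Set X).indicator (fun _ => 1) x)
    (fun U => Set.indicator_le_self' (fun _ _ => zero_le) x)
    (fun U V hUV => Set.indicator_le_indicator_of_subset hUV (fun _ => zero_le) x)
    (fun U _ a ha => by
      by_cases hx : x ∈ ⨆ n, U n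
      · rw [Set.indicator_of_mem hx] at ha
        obtain ⟨n, hn⟩ := Opens.mem_iSup.1 hx
        exact ⟨n, by rwa [Set.indicator_of_mem (show x ∈ (U n : Set X) from hn)]⟩
      · rw [Set.indicator_of_notMem hx] at ha
        exact absurd ha not_lt_zero)
    (by simp)
    (fun U V => by
      by_cases hU : x ∈ U <;> by_cases hV : x ∈ V <;> simp [Set.indicator, hU, hV])

@[simp] lemma mass_dirac [SecondCountableTopology X] (x : X) (U : Opens X) :
    (dirac x).mass U = (U : Set X).indicator (fun _ => 1) x := rfl

lemma continuous_dirac [SecondCountableTopology X] : Continuous (dirac : X → ContValuation X) :=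
  continuous_iff.2 fun U => lowerSemicontinuous_indicator U 1

variable {Y : Type*} [TopologicalSpace Y] [SecondCountableTopology Y]

lemma lowerSemicontinuous_mass_comp {f : X → ContValuation Y} (hf : Continuous f) (U : Opens Y) :
    LowerSemicontinuous fun x => (f x).mass U :=
  continuous_iff.1 hf U

/-- The extension `μ >>= f` of a valuation along a kernel `f`. -/
noncomputable def bind (μ : ContValuation X) (f : X → ContValuation Y) (hf : Continuous f) :
    ContValuation Y :=
  have hfin : ∀ U, μ.choquet (fun x => (f x).mass U) ≠ ∞ := fun U =>
    μ.choquet_ne_top fun x => (f x).mass_le_one U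
  ofMass (fun U => (μ.choquet fun x => (f x).mass U).toNNReal)
    (fun U => ENNReal.toNNReal_mono ENNReal.coe_ne_top (μ.choquet_le fun x => (f x).mass_le_one U))
    (fun U V hUV => ENNReal.toNNReal_mono (hfin V) (μ.choquet_mono fun x => (f x).mass_mono hUV))
    (fun U hU a ha => by
      have ha' : (a : ℝ≥0∞) < μ.choquet fun x => (f x).mass (⨆ n, U n) := by
        rwa [← ENNReal.coe_toNNReal (hfin _), ENNReal.coe_lt_coe]
      rw [μ.choquet_eq_iSup (s := fun n x => (f x).mass (U n))
        (lowerSemicontinuous_mass_comp hf _) (fun n => lowerSemicontinuous_mass_comp hf _)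
        (fun x m n hmn => (f x).mass_mono (hU hmn)) (fun n x => (f x).mass_mono (le_iSup U n))
        (fun x a ha => exists_lt_massOf_of_directed (f x).1 hU.directed_le ha)] at ha'
      obtain ⟨n, hn⟩ := lt_iSup_iff.1 ha'
      refine ⟨n, ?_⟩
      rwa [← ENNReal.coe_lt_coe, ENNReal.coe_toNNReal (hfin _)])
    (by simp)
    (fun U V => by
      rw [← ENNReal.toNNReal_add (hfin _) (hfin _), ← ENNReal.toNNReal_add (hfin _) (hfin _)]
      congr 1
      have hadd := fun U V : Opens Y => μ.choquet_add (lowerSemicontinuous_mass_comp hf U)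
        (fun x => (f x).mass_le_one U) (lowerSemicontinuous_mass_comp hf V)
        (fun x => (f x).mass_le_one V)
      rw [← hadd, ← hadd]
      simp only [← mass_modular])

lemma mass_bind (f : X → ContValuation Y) (hf : Continuous f) (U : Opens Y) :
    ((μ.bind f hf).mass U : ℝ≥0∞) = μ.choquet fun x => (f x).mass U :=
  ENNReal.coe_toNNReal (μ.choquet_ne_top fun x => (f x).mass_le_one U)

lemma mass_bind_eq_integral (f : X → ContValuation Y) (hf : Continuous f) (U : Opens Y) :
    ((μ.bind f hf).mass U : ℝ≥0∞) = μ.integral fun x => (f x).mass U := by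
  rw [mass_bind, integral_eq_choquet _ (lowerSemicontinuous_mass_comp hf U)
    fun x => (f x).mass_le_one U]

lemma continuous_bind [SecondCountableTopology X] (f : X → ContValuation Y) (hf : Continuous f) :
    Continuous fun μ : ContValuation X => μ.bind f hf := by
  refine continuous_iff.2 fun U => lowerSemicontinuous_iff_isOpen_preimage.2 fun a => ?_
  have := (lowerSemicontinuous_integral fun x => (f x).mass U).isOpen_preimage (a : ℝ≥0∞)
  convert this using 1
  ext μ
  simp [← mass_bind_eq_integral (hf := hf)]

lemma dirac_bind [SecondCountableTopology X] (f : X → ContValuation Y) (hf : Continuous f) (x : X) :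
    (dirac x).bind f hf = f x := by
  ext1 U
  rw [← ENNReal.coe_inj, mass_bind, choquet]
  have hlev : ∀ t : ℝ, ((dirac x).mass (superlevel (fun y => (f y).mass U) t) : ℝ≥0∞) =
      (Set.Iio ((f x).mass U : ℝ)).indicator 1 t := by
    intro t
    have := mem_superlevel (lowerSemicontinuous_mass_comp hf U) (t := t) (x := x)
    by_cases ht : t < (f x).mass U <;> simp [Set.indicator, this, ht]
  rw [lintegral_congr hlev, lintegral_indicator_one measurableSet_Iio,
    Measure.restrict_apply measurableSet_Iio, Set.inter_comm, Set.Ici_inter_Iio, Real.volume_Ico]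
  simp

lemma bind_dirac [SecondCountableTopology X] : μ.bind dirac continuous_dirac = μ := by
  ext1 U
  rw [← ENNReal.coe_inj, mass_bind]
  exact μ.choquet_indicator_one U

lemma mass_bind_dirac_comp (f : C(X, Y)) (U : Opens Y) :
    (μ.bind (fun x => dirac (f x)) (continuous_dirac.comp f.continuous)).mass U =
      μ.mass (U.comap f) := by
  rw [← ENNReal.coe_inj, mass_bind]
  exact μ.choquet_indicator_one (U.comap f)

/-- Integration against `μ >>= f` is iterated integration. For step functions this is linearity of
the integral against `μ`, and both sides depend continuously on the integrand in the uniform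
norm. -/
lemma choquet_bind (f : X → ContValuation Y) (hf : Continuous f) {h : Y → ℝ≥0}
    (hh : LowerSemicontinuous h) (h1 : ∀ y, h y ≤ 1) :
    (μ.bind f hf).choquet h = μ.choquet fun x => ((f x).choquet h).toNNReal := by
  have key : ∀ ε : ℝ≥0, 0 < ε →
      (μ.bind f hf).choquet h ≤ (μ.choquet fun x => ((f x).choquet h).toNNReal) + ε ∧
      (μ.choquet fun x => ((f x).choquet h).toNNReal) ≤ (μ.bind f hf).choquet h + ε := by
    intro ε hε
    obtain ⟨n, a, U, hs1, hs2⟩ := exists_step_le hh h1 hε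
    have hstep : ∀ ν : ContValuation Y, ν.choquet (step a U) =
        (∑ i, a i * ν.mass (U i) : ℝ≥0) := fun ν => by
      rw [choquet_step]; push_cast; rfl
    have hs : (μ.bind f hf).choquet (step a U) = μ.choquet fun x => ∑ i, a i * (f x).mass (U i) := by
      rw [choquet_step, μ.choquet_sum_mul (fun i => lowerSemicontinuous_mass_comp hf _)
        fun i x => (f x).mass_le_one _]
      simp only [mass_bind]
    have happrox : ∀ ν : ContValuation Y, ν.choquet h ≤ ν.choquet (step a U) + ε := fun ν =>
      (ν.choquet_mono hs2).trans
        (ν.choquet_add_const_le (lowerSemicontinuous_step a U) (step_le a U) ε)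
    constructor
    · refine (happrox _).trans (add_le_add_left ?_ _)
      rw [hs]
      refine μ.choquet_mono fun x => ?_
      rw [← ENNReal.coe_le_coe, ENNReal.coe_toNNReal ((f x).choquet_ne_top h1), ← hstep]
      exact (f x).choquet_mono hs1
    · calc μ.choquet (fun x => ((f x).choquet h).toNNReal)
          ≤ μ.choquet (fun x => ∑ i, a i * (f x).mass (U i) + ε) := μ.choquet_mono fun x => by
            rw [← ENNReal.coe_le_coe, ENNReal.coe_toNNReal ((f x).choquet_ne_top h1),
              ENNReal.coe_add, ← hstep]
            exact happrox _
        _ ≤ μ.choquet (fun x => ∑ i, a i * (f x).mass (U i)) + ε :=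
            μ.choquet_add_const_le (M := ∑ i, a i * 1)
              (lowerSemicontinuous_sum fun i _ =>
                lowerSemicontinuous_const_mul (lowerSemicontinuous_mass_comp hf _) _)
              (fun x => Finset.sum_le_sum fun i _ => mul_le_mul_right ((f x).mass_le_one _) _) ε
        _ ≤ _ := by
            rw [← hs]
            exact add_le_add_left ((μ.bind f hf).choquet_mono hs1) _
  exact le_antisymm (ENNReal.le_of_forall_pos_le_add fun ε hε _ => (key ε hε).1)
    (ENNReal.le_of_forall_pos_le_add fun ε hε _ => (key ε hε).2)

lemma bind_bind {Z : Type*} [TopologicalSpace Z] [SecondCountableTopology Z]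
    (f : X → ContValuation Y) (hf : Continuous f) (g : Y → ContValuation Z) (hg : Continuous g) :
    (μ.bind f hf).bind g hg =
      μ.bind (fun x => (f x).bind g hg) ((continuous_bind g hg).comp hf) := by
  ext1 U
  rw [← ENNReal.coe_inj, mass_bind, mass_bind, choquet_bind _ _ _
    (lowerSemicontinuous_mass_comp hg U) fun y => (g y).mass_le_one U]
  rfl

end ContValuation

/-! ### The monad of valuations -/

instance (D : TPω.{u}) : SecondCountableTopology D.obj := D.property.1

theorem isTPω_contValuation (D : TPω.{u}) : isTPω (TopCat.of (ContValuation D.obj)) :=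
  ContValuation.isTPω_of_secondCountable

/-- Valuations as a Kleisli triple on countably based topological predomains. -/
noncomputable def valuationTriple : KleisliTriple (probObj.{u} isTPω_contValuation) where
  ret D := ObjectProperty.homMk (TopCat.ofHom ⟨ContValuation.dirac, ContValuation.continuous_dirac⟩)
  bind {D E} f := ObjectProperty.homMk (TopCat.ofHom
    ⟨fun μ : ContValuation D.obj => μ.bind (toValuation f) f.hom.hom.continuous,
      ContValuation.continuous_bind _ _⟩)
  ret_bind f := by
    ext x
    exact ContValuation.dirac_bind (X := (_ : TPω).obj) (toValuation f) f.hom.hom.continuous x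
  bind_ret D := by
    ext μ
    exact ContValuation.bind_dirac (X := D.obj) μ
  bind_bind f g := by
    ext μ
    exact ContValuation.bind_bind μ _ f.hom.hom.continuous _ g.hom.hom.continuous

theorem mainTheorem3 :
    ∃ hP : ∀ D : TPω.{u}, isTPω (TopCat.of (ContValuation D.obj)),
    ∃ K : KleisliTriple (probObj hP),
      (∀ (D : TPω.{u}) (x : D.obj) (U : Opens D.obj),
        (toValuation (K.ret D) x).mass U = (U : Set D.obj).indicator (fun _ => (1 : ℝ≥0)) x) ∧
      (∀ (D E : TPω.{u}) (f : D ⟶ probObj hP E) (μ : ContValuation D.obj) (U : Opens E.obj),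
        ((toValuation (D := probObj hP D) (K.bind f) μ).mass U : ℝ≥0∞) =
          μ.integral (fun x => (toValuation f x).mass U)) ∧
      (∀ (D E : TPω.{u}) (f : D ⟶ E) (μ : ContValuation D.obj) (U : Opens E.obj),
        (toValuation (D := probObj hP D) (E := E) (K.toMonad.map f) μ).mass U =
          μ.mass (preimageOpen f U)) := by
  refine ⟨isTPω_contValuation, valuationTriple, fun D x U => rfl, fun D E f μ U => ?_,
    fun D E f μ U => ?_⟩
  · exact μ.mass_bind_eq_integral _ f.hom.hom.continuous U
  · exact μ.mass_bind_dirac_comp f.hom.hom U
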